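/- Let $(R,\mathfrak m)$ be a Noetherian Cohen–Macaulay local ring of Krull dimension $2$ and let $I$ be an $\mathfrak m$-primary ideal of $R$. An ideal $J\subseteq I$ is a reduction of $I$ if $JI^n=I^{n+1}$ for some $n\ge 0$; it is a minimal reduction if it is minimal under inclusion among the reductions of $I$. For a reduction $J$ of $I$ let $\operatorname{rd}_J(I)$ be the least $n\ge 0$ with $JI^n=I^{n+1}$, and let $\operatorname{rd}(I)$ be the minimum of $\operatorname{rd}_J(I)$ over all minimal reductions $J$ of $I$. For $n\in\mathbb Z$ let $H_I(n)$ be the length of $R/I^n$ (with $I^n=R$ for $n\le 0$), let $P_I$ be the Hilbert–Samuel polynomial, i.e. the polynomial with $P_I(n)=H_I(n)$ for all large $n$, and let $\operatorname{n}(I)=\min\{n\in\mathbb Z: P_I(t)=H_I(t)\text{ for all integers } t>n\}$ be the postulation number. Write $\widetilde{K}=\bigcup_{n\ge 1}(K^{n+1}:K^n)$ for the Ratliff–Rush closure of an ideal $K$, and let $\rho(I)=\min\{i\ge 1:\widetilde{I^n}=I^n\text{ for all } n\ge i\}$. An element $x\in I$ is superficial for $I$ if there is a positive integer $c$ such that $(I^{n+1}:x)\cap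 I^c=I^n$ for all $n\ge c$. Let $J=(x,y)$ be a minimal reduction of $I$ such that $x$ is superficial for $I$. If $\operatorname{n}(I)=\rho(I)-1$, then $$\operatorname{rd}(I)\le \operatorname{n}(I)+2 \qquad\text{and}\qquad \operatorname{rd}_J(I)\le\rho(I)+1 .$$ -/

import Mathlib

noncomputable section

open Polynomial

namespace HilbertSamuel

/-- The depth of a local ring: the supremum of the lengths of the regular sequences
contained in the maximal ideal. -/
def depth (R : Type*) [CommRing R] [IsLocalRing R] : ℕ∞ :=
  ⨆ rs ∈ {rs : List R | RingTheory.Sequence.IsRegular R rs ∧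
    ∀ r ∈ rs, r ∈ IsLocalRing.maximalIdeal R}, (rs.length : ℕ∞)

/-- A Cohen-Macaulay local ring: a Noetherian local ring whose depth equals its Krull
dimension. -/
structure IsCohenMacaulayLocal (R : Type*) [CommRing R] [IsLocalRing R] : Prop where
  noetherian : IsNoetherianRing R
  depth_eq_dim : (depth R : WithBot ℕ∞) = ringKrullDim R

variable {R : Type*} [CommRing R]

/-- `I` is primary to the maximal ideal of the local ring `R`. -/
def IsMPrimary [IsLocalRing R] (I : Ideal R) : Prop :=
  I.IsPrimary ∧ I.radical = IsLocalRing.maximalIdeal R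

/-- `J` is a reduction of `I`. -/
def IsReduction (I J : Ideal R) : Prop :=
  J ≤ I ∧ ∃ n : ℕ, J * I ^ n = I ^ (n + 1)

/-- `J` is a minimal reduction of `I`: minimal for inclusion among all reductions of `I`. -/
def IsMinimalReduction (I J : Ideal R) : Prop :=
  Minimal (IsReduction I) J

/-- The reduction number `rd_J(I)` of `I` with respect to a reduction `J`. -/
def reductionNumberWrt (I J : Ideal R) : ℕ :=
  sInf {n : ℕ | J * I ^ n = I ^ (n + 1)}

/-- The reduction number `rd(I)`: the minimum of `rd_J(I)` over all minimal reductions `J`. -/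
def reductionNumber (I : Ideal R) : ℕ :=
  sInf {k : ℕ | ∃ J : Ideal R, IsMinimalReduction I J ∧ reductionNumberWrt I J = k}

/-- The Hilbert-Samuel function `H_I(n) = λ(R / I ^ n)`, where `I ^ n = R` for `n ≤ 0`. -/
def hilbertFunction (I : Ideal R) (n : ℤ) : ℕ :=
  (Module.length R (R ⧸ I ^ n.toNat)).toNat

/-- `P` agrees with the Hilbert-Samuel function of `I` at all large integers. -/
def IsHilbertPolynomial (I : Ideal R) (P : ℚ[X]) : Prop :=
  ∃ N : ℤ, ∀ n : ℤ, N ≤ n → P.eval (n : ℚ) = (hilbertFunction I n : ℚ)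

/-- There is at most one Hilbert-Samuel polynomial. -/
theorem IsHilbertPolynomial.unique {I : Ideal R} {P Q : ℚ[X]}
    (hP : IsHilbertPolynomial I P) (hQ : IsHilbertPolynomial I Q) : P = Q := by
  obtain ⟨N, hN⟩ := hP
  obtain ⟨M, hM⟩ := hQ
  refine Polynomial.eq_of_infinite_eval_eq P Q ?_
  refine ((Set.Ici_infinite (max N M)).image
    (f := fun n : ℤ => (n : ℚ)) (Int.cast_injective.injOn)).mono ?_
  rintro _ ⟨n, hn, rfl⟩
  have h1 : N ≤ n := (le_max_left N M).trans hn
  have h2 : M ≤ n := (le_max_right N M).trans hn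
  change P.eval (n : ℚ) = Q.eval (n : ℚ)
  rw [hN n h1, hM n h2]

open Classical in
/-- The Hilbert-Samuel polynomial `P_I` (it exists whenever `I` is primary to the maximal ideal
of a Noetherian local ring; the value where it does not exist is a convention). -/
def hilbertPolynomial (I : Ideal R) : ℚ[X] :=
  if h : ∃ P : ℚ[X], IsHilbertPolynomial I P then h.choose else 0

/-- The postulation number
`n(I) = min {n ∈ ℤ : P_I(t) = H_I(t) for all integers t > n}`. -/
def postulationNumber (I : Ideal R) : ℤ :=
  sInf {n : ℤ | ∀ t : ℤ, n < t →
    (hilbertPolynomial I).eval (t : ℚ) = (hilbertFunction I t : ℚ)}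

/-- The Ratliff-Rush closure, the union of the increasing chain of the ideals
`(I ^ (n + 1) : I ^ n)` for `n ≥ 1`. -/
def ratliffRush (I : Ideal R) : Ideal R :=
  ⨆ n ∈ {n : ℕ | 1 ≤ n}, Submodule.colon (I ^ (n + 1)) ((I ^ n : Ideal R) : Set R)

/-- The stability index `ρ(I)` of the Ratliff-Rush filtration. -/
def stabilityIndex (I : Ideal R) : ℕ :=
  sInf {i : ℕ | 1 ≤ i ∧ ∀ n : ℕ, i ≤ n → ratliffRush (I ^ n) = I ^ n}

/-- `x` is a superficial element for `I`. -/
def IsSuperficial (I : Ideal R) (x : R) : Prop :=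
  x ∈ I ∧ ∃ c : ℕ, 0 < c ∧ ∀ n : ℕ, c ≤ n →
    Submodule.colon (I ^ (n + 1)) {x} ⊓ I ^ c = I ^ n

end HilbertSamuel

end

/-!
Put `λ` for length and let `J = (x, y)` be a reduction of `I`. Depth at least `2` makes the Koszul
complex of `x, y` exact, which gives
`λ(R / J I^(n+1)) + λ(R / (I^(n+1) : J)) = λ(R / J) + 2 λ(R / I^(n+1))`.
The colon ideal `I^(n+1) : J` lies in the Ratliff-Rush closure of `I^n`, so it equals `I^n` as soon
as `n ≥ ρ(I)`; for such `n`, therefore, `J I^(n+1) = I^(n+2)` holds if and only if the second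
difference `Δ²H_I(n)` equals `λ(R / J)`. Since `J` is a reduction this is the case for large `n`,
so the polynomial `Δ²P_I` is the constant `λ(R / J)`, and hence `Δ²H_I(n) = λ(R / J)` for all
`n > n(I)`. When `n(I) < ρ(I)` this applies to `n = ρ(I)`.
-/

namespace HilbertSamuel

section Length

variable {R : Type*}

theorem length_quotient_ker_add_length_of_exact [Ring R] {A B C D : Type*}
    [AddCommGroup A] [AddCommGroup B] [AddCommGroup C] [AddCommGroup D]
    [Module R A] [Module R B] [Module R C] [Module R D]
    {f : A →ₗ[R] B} {g : B →ₗ[R] C} {p : C →ₗ[R] D}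
    (hfg : Function.Exact f g) (hgp : Function.Exact g p) (hp : Function.Surjective p) :
    Module.length R (A ⧸ LinearMap.ker f) + Module.length R C =
      Module.length R B + Module.length R D := by
  have hker : Module.length R (A ⧸ LinearMap.ker f) = Module.length R (LinearMap.ker g) := by
    rw [LinearMap.exact_iff.mp hfg]
    exact f.quotKerEquivRange.length_eq
  have hB := Module.length_eq_add_of_exact (LinearMap.ker g).subtype g.rangeRestrict
    (Submodule.subtype_injective _) g.surjective_rangeRestrict
    (by rw [LinearMap.exact_iff, LinearMap.ker_rangeRestrict, Submodule.range_subtype])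
  have hC := Module.length_eq_add_of_exact (LinearMap.range g).subtype p
    (Submodule.subtype_injective _) hp
    (by rw [LinearMap.exact_iff, Submodule.range_subtype, LinearMap.exact_iff.mp hgp])
  rw [hB, hC, hker, add_assoc]

theorem eq_of_le_of_length_quotient_eq [Ring R] {M : Type*} [AddCommGroup M] [Module R M]
    {A B : Submodule R M} (hAB : A ≤ B) (hB : Module.length R (M ⧸ B) ≠ ⊤)
    (h : Module.length R (M ⧸ A) = Module.length R (M ⧸ B)) : A = B := by
  rw [Module.length_quotient, Module.length_quotient] at h
  rw [Module.length_quotient] at hB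
  by_contra hne
  exact (Order.coheight_strictAnti (hAB.lt_of_ne hne) hB.lt_top).ne' h

variable [CommRing R] [IsLocalRing R] [IsNoetherianRing R] {I : Ideal R}

theorem length_quotient_ne_top_of_radical_eq (hI : I.radical = IsLocalRing.maximalIdeal R) :
    Module.length R (R ⧸ I) ≠ ⊤ := by
  have : IsArtinianRing (R ⧸ I) := by
    refine IsLocalRing.quotient_artinian_of_mem_minimalPrimes_of_isLocalRing I ?_
    rw [← Ideal.radical_minimalPrimes, hI, Ideal.minimalPrimes_eq_subsingleton_self]
    exact Set.mem_singleton _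
  rw [Module.length_eq_of_surjective (S := R) (R := R ⧸ I) Ideal.Quotient.mk_surjective]
  exact Module.length_ne_top

theorem length_quotient_pow_ne_top_of_radical_eq
    (hI : I.radical = IsLocalRing.maximalIdeal R) (n : ℕ) : Module.length R (R ⧸ I ^ n) ≠ ⊤ := by
  rcases eq_or_ne n 0 with rfl | hn
  · have : Subsingleton (R ⧸ I ^ 0) := by
      rw [pow_zero, Ideal.one_eq_top]
      infer_instance
    simp
  · exact length_quotient_ne_top_of_radical_eq ((I.radical_pow hn).trans hI)

end Length

section RegularSequences

open RingTheory.Sequence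

theorem exists_isRegular_of_le_radical {R : Type*} [CommRing R] [IsNoetherianRing R]
    {A J : Ideal R} (hJ : J ≠ ⊤) (hAJ : A ≤ J.radical) {rs : List R} (hrs : IsRegular R rs)
    (hmem : ∀ r ∈ rs, r ∈ A) :
    ∃ ts : List R, ts.length = rs.length ∧ (∀ r ∈ ts, r ∈ J) ∧ IsRegular R ts := by
  have hrad : J.radical ≠ ⊤ := by rwa [Ne, Ideal.radical_eq_top]
  have hlt : ∀ {K : Ideal R}, K ≠ ⊤ → K • (⊤ : Submodule R R) < ⊤ := fun hK => by
    simpa [lt_top_iff_ne_top] using hK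
  have hsupp : Module.support R (R ⧸ J) = PrimeSpectrum.zeroLocus J := by
    rw [Module.support_eq_zeroLocus, Ideal.annihilator_quotient]
  have hext := ModuleCat.subsingleton_ext_of_exists_isRegular A (ModuleCat.of R (R ⧸ J))
    (hsupp.trans_subset ((PrimeSpectrum.zeroLocus_radical _).ge.trans
      (PrimeSpectrum.zeroLocus_anti_mono_ideal hAJ)))
    (ModuleCat.of R R) (hlt (ne_top_of_le_ne_top hrad hAJ)) rs hmem hrs
  exact ModuleCat.exists_isRegular_of_exists_subsingleton_ext J rs.length (ModuleCat.of R R)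
    (hlt hJ) (ModuleCat.of R (R ⧸ J)) hsupp hext

open scoped Pointwise in
theorem isWeaklyRegular_pair_iff {R : Type*} [CommRing R] {f g : R} : IsWeaklyRegular R [f, g] ↔
    (∀ u, f * u = 0 → u = 0) ∧ ∀ u, f ∣ g * u → f ∣ u := by
  rw [isWeaklyRegular_cons_iff, isWeaklyRegular_singleton_iff,
    isSMulRegular_iff_right_eq_zero_of_smul, isSMulRegular_quotient_iff_mem_of_smul_mem]
  simp [← Ideal.mem_span_singleton, ← Submodule.ideal_span_singleton_smul]

theorem exists_isRegular_of_lt_depth {R : Type*} [CommRing R] [IsLocalRing R] {n : ℕ}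
    (hn : n < depth R) : ∃ rs : List R, n < rs.length ∧
      (∀ r ∈ rs, r ∈ IsLocalRing.maximalIdeal R) ∧ IsRegular R rs := by
  simp only [depth, lt_iSup_iff, Set.mem_ofPred_eq, Nat.cast_lt] at hn
  obtain ⟨rs, ⟨hrs, hmem⟩, hlen⟩ := hn
  exact ⟨rs, hlen, hmem, hrs⟩

theorem exists_isWeaklyRegular_pair_of_two_le_depth {R : Type*} [CommRing R] [IsLocalRing R]
    [IsNoetherianRing R] (hd : 2 ≤ depth R) {J : Ideal R}
    (hJ : J.radical = IsLocalRing.maximalIdeal R) :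
    ∃ f ∈ J, ∃ g ∈ J, IsWeaklyRegular R [f, g] := by
  have hJ_top : J ≠ ⊤ := by
    rw [← Ideal.radical_eq_top.ne, hJ]
    exact Ideal.IsPrime.ne_top'
  obtain ⟨rs, hlen, hmem, hrs⟩ := exists_isRegular_of_lt_depth (R := R) (n := 1)
    (lt_of_lt_of_le (by norm_num) hd)
  obtain ⟨ts, hts, htsJ, hreg⟩ := exists_isRegular_of_le_radical hJ_top hJ.ge hrs hmem
  match ts, htsJ, hreg with
  | [], _, _ => simp at hts; lia
  | [_], _, _ => simp at hts; lia
  | f :: g :: t, htsJ, hreg =>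
    exact ⟨f, htsJ f (by simp), g, htsJ g (by simp),
      ((isWeaklyRegular_append_iff R [f, g] t).mp hreg.toIsWeaklyRegular).1⟩

end RegularSequences

section Koszul

variable {R : Type*} [CommRing R] {x y : R}

/-- Exactness of the Koszul complex `R → R² → R` of `x, y` at `R²`: every syzygy of `x, y` is a
multiple of the trivial one. -/
def IsKoszulExact (x y : R) : Prop :=
  ∀ p q, x * p + y * q = 0 → ∃ c, p = y * c ∧ q = -(x * c)

theorem isKoszulExact_of_isWeaklyRegular {f g : R}
    (hf : f ∈ Ideal.span {x, y}) (hg : g ∈ Ideal.span {x, y})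
    (hfg : RingTheory.Sequence.IsWeaklyRegular R [f, g]) : IsKoszulExact x y := by
  intro p q hpq
  obtain ⟨hf_reg, hg_reg⟩ := isWeaklyRegular_pair_iff.mp hfg
  -- The Koszul complex is homotopic to zero along multiplication by any element of `(x, y)`.
  have homotopy : ∀ {h}, h ∈ Ideal.span {x, y} → ∃ c, h * p = y * c ∧ h * q = -(x * c) := by
    intro h hh
    obtain ⟨a, b, rfl⟩ := Ideal.mem_span_pair.mp hh
    exact ⟨b * p - a * q, by linear_combination a * hpq, by linear_combination b * hpq⟩
  obtain ⟨c, hfp, hfq⟩ := homotopy hf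
  obtain ⟨d, hgp, hgq⟩ := homotopy hg
  have hcd : g * c = f * d := by
    rw [← sub_eq_zero]
    apply hf_reg
    obtain ⟨a, b, hab⟩ := Ideal.mem_span_pair.mp hf
    linear_combination
      (f * d - g * c) * hab + a * (g * hfq - f * hgq) + b * (f * hgp - g * hfp)
  obtain ⟨e, rfl⟩ := hg_reg c ⟨d, hcd⟩
  refine ⟨e, sub_eq_zero.mp (hf_reg _ ?_), sub_eq_zero.mp (hf_reg _ ?_)⟩
  · linear_combination hfp
  · linear_combination hfq

end Koszul

section KoszulQuotient

variable {R : Type*} [CommRing R]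

/-- The map `c ↦ (y c, -x c)` from `R` to `(R ⧸ K)²`, the left part of the Koszul complex of
`x, y` with coefficients reduced modulo `K`. -/
def koszulLeft (x y : R) (K : Ideal R) : R →ₗ[R] (R ⧸ K) × (R ⧸ K) :=
  (K.mkQ ∘ₗ LinearMap.mulLeft R y).prod (-(K.mkQ ∘ₗ LinearMap.mulLeft R x))

theorem le_comap_mulLeft {J : Ideal R} {z : R} (hz : z ∈ J) (K : Ideal R) :
    K ≤ Submodule.comap (LinearMap.mulLeft R z) (J * K) :=
  fun _ hk => Ideal.mul_mem_mul hz hk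

/-- The map `(a, b) ↦ x a + y b` from `(R ⧸ K)²` to `R ⧸ (x, y) K`, the right part of the Koszul
complex of `x, y`; its target is `R ⧸ (x, y) K` rather than `R ⧸ K` so that exactness descends
from `R`. -/
def koszulRight (x y : R) (K : Ideal R) :
    (R ⧸ K) × (R ⧸ K) →ₗ[R] R ⧸ Ideal.span {x, y} * K :=
  (K.mapQ _ (LinearMap.mulLeft R x) (le_comap_mulLeft (Ideal.subset_span (by simp)) K)).coprod
    (K.mapQ _ (LinearMap.mulLeft R y) (le_comap_mulLeft (Ideal.subset_span (by simp)) K))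

theorem koszulRight_mkQ (x y : R) (K : Ideal R) (a b : R) :
    koszulRight x y K (K.mkQ a, K.mkQ b) = (Ideal.span {x, y} * K).mkQ (x * a + y * b) :=
  (map_add (Ideal.span {x, y} * K).mkQ _ _).symm

theorem ker_koszulLeft (x y : R) (K : Ideal R) :
    LinearMap.ker (koszulLeft x y K) = K.colon (Ideal.span {x, y} : Ideal R) := by
  ext c
  simp [koszulLeft, Submodule.mem_colon, -map_mul,
    Ideal.Quotient.eq_zero_iff_mem, and_comm, mul_comm]

theorem exact_koszulLeft_koszulRight {x y : R} (hxy : IsKoszulExact x y) (K : Ideal R) :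
    Function.Exact (koszulLeft x y K) (koszulRight x y K) := by
  rintro ⟨a, b⟩
  obtain ⟨a, rfl⟩ := K.mkQ_surjective a
  obtain ⟨b, rfl⟩ := K.mkQ_surjective b
  constructor
  · intro h
    rw [koszulRight_mkQ, Submodule.mkQ_apply, Submodule.Quotient.mk_eq_zero, Ideal.span_insert,
      Ideal.sup_mul] at h
    obtain ⟨_, hxk, _, hyl, hkl⟩ := Submodule.mem_sup.mp h
    obtain ⟨k, hk, rfl⟩ := Ideal.mem_span_singleton_mul.mp hxk
    obtain ⟨l, hl, rfl⟩ := Ideal.mem_span_singleton_mul.mp hyl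
    obtain ⟨c, ha, hb⟩ := hxy (a - k) (b - l) (by linear_combination -hkl)
    refine ⟨c, Prod.ext ?_ ?_⟩
    · refine (Submodule.Quotient.eq K).mpr ?_
      simpa [← ha] using hk
    · refine (Submodule.Quotient.eq K).mpr ?_
      simpa [← hb] using hl
  · rintro ⟨c, hc⟩
    rw [← hc]
    refine (koszulRight_mkQ x y K (y * c) (-(x * c))).trans ?_
    rw [show x * (y * c) + y * -(x * c) = 0 by ring, map_zero]

theorem exact_koszulRight_factor (x y : R) (K : Ideal R) :
    Function.Exact (koszulRight x y K)
      (Submodule.factor (Ideal.mul_le_left : Ideal.span {x, y} * K ≤ Ideal.span {x, y})) := by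
  intro z
  obtain ⟨z, rfl⟩ := Submodule.mkQ_surjective _ z
  constructor
  · intro hz
    obtain ⟨a, b, rfl⟩ := Ideal.mem_span_pair.mp ((Submodule.Quotient.mk_eq_zero _).mp hz)
    exact ⟨(K.mkQ a, K.mkQ b), by rw [koszulRight_mkQ, mul_comm x, mul_comm y]⟩
  · rintro ⟨⟨a, b⟩, hab⟩
    obtain ⟨a, rfl⟩ := K.mkQ_surjective a
    obtain ⟨b, rfl⟩ := K.mkQ_surjective b
    rw [← hab, koszulRight_mkQ]
    exact (Submodule.Quotient.mk_eq_zero _).mpr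
      (Ideal.mem_span_pair.mpr ⟨a, b, by rw [mul_comm x, mul_comm y]; rfl⟩)

theorem length_quotient_mul_add {x y : R} (hxy : IsKoszulExact x y) (K : Ideal R) :
    Module.length R (R ⧸ K.colon (Ideal.span {x, y} : Ideal R)) +
        Module.length R (R ⧸ Ideal.span {x, y} * K) =
      2 * Module.length R (R ⧸ K) + Module.length R (R ⧸ Ideal.span {x, y}) := by
  rw [← ker_koszulLeft, length_quotient_ker_add_length_of_exact
    (exact_koszulLeft_koszulRight hxy K) (exact_koszulRight_factor x y K)
    (Submodule.factor_surjective _), Module.length_prod, two_mul]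

end KoszulQuotient

open Polynomial
open scoped fwdDiff

section FiniteDifferences

theorem fwdDiff_iter_congr {G : Type*} [AddCommGroup G] {f g : ℤ → G} {n : ℤ}
    (h : ∀ t, n ≤ t → f t = g t) (d : ℕ) : (Δ_[1])^[d] f n = (Δ_[1])^[d] g n := by
  simp only [fwdDiff_iter_eq_sum_shift]
  exact Finset.sum_congr rfl fun k _ => by rw [h _ (by simp)]

theorem exists_polynomial_eval_eq_fwdDiff_iter {A : Type*} [CommRing A] (P : A[X]) (d : ℕ) :
    ∃ Q : A[X], ∀ n : ℤ, Q.eval (n : A) = (Δ_[1])^[d] (fun t : ℤ => P.eval (t : A)) n := by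
  refine ⟨∑ k ∈ Finset.range (d + 1), ((-1 : ℤ) ^ (d - k) * d.choose k) • P.comp (X + C (k : A)),
    fun n => ?_⟩
  simp [fwdDiff_iter_eq_sum_shift, eval_finsetSum]

theorem fwdDiff_iter_eval_eq_of_eventually_eq {A : Type*} [CommRing A] [IsDomain A] [CharZero A]
    (P : A[X]) {d : ℕ} {e : A} {N : ℤ}
    (h : ∀ n, N ≤ n → (Δ_[1])^[d] (fun t : ℤ => P.eval (t : A)) n = e) (n : ℤ) :
    (Δ_[1])^[d] (fun t : ℤ => P.eval (t : A)) n = e := by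
  obtain ⟨Q, hQ⟩ := exists_polynomial_eval_eq_fwdDiff_iter P d
  have hQe : Q = C e := by
    refine eq_of_infinite_eval_eq Q (C e) <|
      ((Set.Ici_infinite N).image (Int.cast_injective (α := A)).injOn).mono ?_
    rintro _ ⟨t, ht, rfl⟩
    rw [Set.mem_ofPred_eq, hQ, h t ht, eval_C]
  rw [← hQ, hQe, eval_C]

variable {K : Type*} [Field K] [CharZero K]

/-- The Newton interpolation polynomial `∑ j < d, a j * ((X - N) choose j)`. It recovers a function
with vanishing `d`-th differences from its iterated differences `a j` at `N`. -/
noncomputable def newtonPolynomial (N : K) (a : ℕ → K) (d : ℕ) : K[X] :=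
  ∑ j ∈ Finset.range d, C (a j / j.factorial) * (descPochhammer K j).comp (X - C N)

theorem eval_newtonPolynomial_add_natCast (N : K) (a : ℕ → K) (d k : ℕ) :
    (newtonPolynomial N a d).eval (N + k) = ∑ j ∈ Finset.range d, k.choose j * a j := by
  simp only [newtonPolynomial, eval_finsetSum, eval_mul, eval_C, eval_comp, eval_sub, eval_X,
    add_sub_cancel_left, Nat.cast_choose_eq_descPochhammer_div]
  exact Finset.sum_congr rfl fun j _ => by ring

theorem eval_newtonPolynomial_of_fwdDiff_iter_eq_zero {f : ℤ → K} {d : ℕ} {N : ℤ}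
    (hf : ∀ n, N ≤ n → (Δ_[1])^[d] f n = 0) {n : ℤ} (hn : N ≤ n) :
    (newtonPolynomial (N : K) (fun j => (Δ_[1])^[j] f N) d).eval (n : K) = f n := by
  obtain ⟨k, rfl⟩ := Int.le.dest hn
  have hzero : ∀ j, d ≤ j → (Δ_[1])^[j] f N = 0 := fun j hj => by
    obtain ⟨i, rfl⟩ := Nat.exists_eq_add_of_le' hj
    rw [Function.iterate_add_apply, fwdDiff_iter_congr (g := 0) hf]
    simp [fwdDiff_iter_eq_sum_shift]
  have hshift := shift_eq_sum_fwdDiff_iter 1 f k N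
  rw [nsmul_one] at hshift
  push_cast
  rw [eval_newtonPolynomial_add_natCast, hshift]
  refine Finset.sum_congr_of_eq_on_inter (fun j _ hj => ?_) (fun j _ hj => ?_) fun j _ _ =>
    (nsmul_eq_mul _ _).symm
  · rw [Nat.choose_eq_zero_of_lt (by simpa using hj), Nat.cast_zero, zero_mul]
  · rw [hzero j (by simpa using hj), smul_zero]

end FiniteDifferences

section HilbertPolynomial

variable {R : Type*} [CommRing R] {I : Ideal R}

theorem IsHilbertPolynomial.hilbertPolynomial {P : ℚ[X]} (hP : IsHilbertPolynomial I P) :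
    IsHilbertPolynomial I (hilbertPolynomial I) := by
  have h : ∃ P : ℚ[X], IsHilbertPolynomial I P := ⟨P, hP⟩
  rw [HilbertSamuel.hilbertPolynomial, dif_pos h]
  exact h.choose_spec

theorem eval_hilbertPolynomial_of_postulationNumber_lt
    (hI : IsHilbertPolynomial I (hilbertPolynomial I)) {t : ℤ} (ht : postulationNumber I < t) :
    (hilbertPolynomial I).eval (t : ℚ) = hilbertFunction I t := by
  by_cases hbdd : BddBelow {n : ℤ | ∀ t : ℤ, n < t →
      (hilbertPolynomial I).eval (t : ℚ) = (hilbertFunction I t : ℚ)}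
  · refine Int.csInf_mem ?_ hbdd t ht
    obtain ⟨N, hN⟩ := hI
    exact ⟨N, fun s hs => hN s hs.le⟩
  -- An infimum that is not attained is a junk value, but then the two functions agree everywhere.
  · obtain ⟨n, hn, hnt⟩ := not_bddBelow_iff.mp hbdd t
    exact hn t hnt

theorem fwdDiff_iter_hilbertFunction_eq {d : ℕ} {e : ℚ} {N : ℤ}
    (h : ∀ n, N ≤ n → (Δ_[1])^[d] (fun t : ℤ => (hilbertFunction I t : ℚ)) n = e) {n : ℤ}
    (hn : postulationNumber I < n) :
    (Δ_[1])^[d] (fun t : ℤ => (hilbertFunction I t : ℚ)) n = e := by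
  have hsucc : ∀ t, N ≤ t → (Δ_[1])^[d + 1] (fun t : ℤ => (hilbertFunction I t : ℚ)) t = 0 :=
    fun t ht => by
      rw [Function.iterate_succ_apply', fwdDiff, h t ht, h (t + 1) (by lia), sub_self]
  obtain ⟨M, hM⟩ := IsHilbertPolynomial.hilbertPolynomial (I := I)
    ⟨N, fun t ht => eval_newtonPolynomial_of_fwdDiff_iter_eq_zero hsucc ht⟩
  rw [← fwdDiff_iter_congr fun t ht =>
    eval_hilbertPolynomial_of_postulationNumber_lt ⟨M, hM⟩ (hn.trans_le ht)]
  refine fwdDiff_iter_eval_eq_of_eventually_eq _ (N := max N M) (fun t ht => ?_) n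
  rw [fwdDiff_iter_congr fun s hs => hM s ((le_of_max_le_right ht).trans hs)]
  exact h t (le_of_max_le_left ht)

end HilbertPolynomial

section RatliffRush

variable {R : Type*} [CommRing R] {I J : Ideal R}

theorem le_colon_iff_mul_le {A B K : Ideal R} : A ≤ K.colon (B : Set R) ↔ A * B ≤ K := by
  rw [Ideal.mul_le]
  exact forall₂_congr fun _ _ => Submodule.mem_colon

theorem colon_pow_le_ratliffRush (I : Ideal R) {n : ℕ} (hn : 1 ≤ n) :
    (I ^ (n + 1)).colon ((I ^ n : Ideal R) : Set R) ≤ ratliffRush I :=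
  le_iSup₂ (f := fun (n : ℕ) (_ : n ∈ {n : ℕ | 1 ≤ n}) =>
    (I ^ (n + 1)).colon ((I ^ n : Ideal R) : Set R)) n hn

theorem le_ratliffRush (I : Ideal R) : I ≤ ratliffRush I :=
  (le_colon_iff_mul_le.mpr (pow_succ' I 1).ge).trans (colon_pow_le_ratliffRush I le_rfl)

theorem ratliffRush_pow_eq {n : ℕ} (h : ∀ m, n ≤ m → (I ^ (m + 1)).colon (I : Set R) ≤ I ^ m) :
    ratliffRush (I ^ n) = I ^ n := by
  have hcancel : ∀ j (K : Ideal R), K * I ^ j ≤ I ^ (n + j) → K ≤ I ^ n := by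
    intro j
    induction j with
    | zero => simp
    | succ j ih =>
      intro K hK
      refine ih K ((le_colon_iff_mul_le.mpr ?_).trans (h (n + j) (Nat.le_add_right n j)))
      rwa [mul_assoc, ← pow_succ]
  refine le_antisymm (iSup₂_le fun k _ => hcancel (n * k) _ ?_) (le_ratliffRush _)
  rw [← pow_mul, ← pow_mul, Nat.mul_succ, Nat.add_comm]
  exact le_colon_iff_mul_le.mp le_rfl

/-- The filtration `b (I ^ (n + 1) : I)`. When `b ∈ I` it lies below `I ^ n`, so the Artin-Rees
property applies to it. -/
def colonFiltration (I : Ideal R) (b : R) : I.Filtration R where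
  N n := Ideal.span {b} * (I ^ (n + 1)).colon (I : Set R)
  mono n := Ideal.mul_mono_right
    (Submodule.colon_mono (Ideal.pow_le_pow_right (Nat.le_succ _)) subset_rfl)
  smul_le n := by
    rw [smul_eq_mul, mul_left_comm, mul_comm I]
    refine Ideal.mul_mono_right ((le_colon_iff_mul_le.mp le_rfl).trans ?_)
    exact le_colon_iff_mul_le.mpr (pow_succ I (n + 1)).ge

theorem colonFiltration_stable [IsNoetherianRing R] {b : R} (hb : b ∈ I) :
    (colonFiltration I b).Stable := by
  refine (I.stableFiltration_stable ⊤).of_le fun n => ?_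
  calc Ideal.span {b} * (I ^ (n + 1)).colon (I : Set R)
      ≤ (I ^ (n + 1)).colon (I : Set R) * I := by
        rw [mul_comm]
        exact Ideal.mul_mono_right (I.span_singleton_le_iff_mem.mpr hb)
    _ ≤ I ^ (n + 1) := le_colon_iff_mul_le.mp le_rfl
    _ ≤ I ^ n • ⊤ := by
        rw [smul_eq_mul, Ideal.mul_top]
        exact Ideal.pow_le_pow_right (Nat.le_succ n)

theorem exists_colon_pow_succ_le_pow [IsNoetherianRing R] {b : R} (hb : b ∈ I)
    (hreg : IsSMulRegular R b) : ∃ n₀, ∀ n, n₀ ≤ n → (I ^ (n + 1)).colon (I : Set R) ≤ I ^ n := by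
  obtain ⟨n₀, hn₀⟩ := colonFiltration_stable hb
  refine ⟨n₀ + 1, fun n hn => ?_⟩
  obtain ⟨n, rfl⟩ := Nat.exists_eq_add_of_le' (show 1 ≤ n by lia)
  have hstable : Ideal.span {b} * (I * (I ^ (n + 1)).colon (I : Set R)) =
      Ideal.span {b} * (I ^ (n + 1 + 1)).colon (I : Set R) := by
    rw [mul_left_comm]
    exact hn₀ n (by lia)
  have hcancel : (I ^ (n + 1 + 1)).colon (I : Set R) ≤ I * (I ^ (n + 1)).colon (I : Set R) := by
    intro z hz
    obtain ⟨w, hw, hzw⟩ := Ideal.span_singleton_mul_le_span_singleton_mul.mp hstable.ge z hz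
    rwa [hreg hzw]
  rw [mul_comm] at hcancel
  exact hcancel.trans (le_colon_iff_mul_le.mp le_rfl)

theorem stabilityIndex_spec [IsNoetherianRing R] {b : R} (hb : b ∈ I)
    (hreg : IsSMulRegular R b) :
    1 ≤ stabilityIndex I ∧ ∀ n, stabilityIndex I ≤ n → ratliffRush (I ^ n) = I ^ n := by
  obtain ⟨n₀, hn₀⟩ := exists_colon_pow_succ_le_pow hb hreg
  refine Nat.sInf_mem
    (s := {i : ℕ | 1 ≤ i ∧ ∀ n : ℕ, i ≤ n → ratliffRush (I ^ n) = I ^ n})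
    ⟨n₀ + 1, Nat.le_add_left 1 n₀, fun n hn => ratliffRush_pow_eq fun m hm => hn₀ m (by lia)⟩

theorem mul_pow_eq_of_le {m n : ℕ} (h : J * I ^ m = I ^ (m + 1)) (hmn : m ≤ n) :
    J * I ^ n = I ^ (n + 1) := by
  obtain ⟨k, rfl⟩ := Nat.exists_eq_add_of_le hmn
  rw [pow_add, ← mul_assoc, h, ← pow_add, Nat.add_right_comm]

namespace IsReduction

theorem radical_eq (hJ : IsReduction I J) : J.radical = I.radical := by
  obtain ⟨hJI, r, hr⟩ := hJ
  refine le_antisymm (Ideal.radical_mono hJI) ?_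
  rw [← I.radical_pow r.succ_ne_zero, ← hr]
  exact Ideal.radical_mono Ideal.mul_le_left

theorem colon_le_ratliffRush (hJ : IsReduction I J) {n : ℕ} (hn : 1 ≤ n) :
    (I ^ (n + 1)).colon (J : Set R) ≤ ratliffRush (I ^ n) := by
  obtain ⟨-, r, hr⟩ := hJ
  refine le_trans (le_colon_iff_mul_le.mpr ?_) (colon_pow_le_ratliffRush _ (Nat.le_add_left 1 r))
  obtain ⟨l, hl⟩ := Nat.exists_eq_add_of_le (Nat.le_mul_of_pos_left (r + 1) hn)
  calc (I ^ (n + 1)).colon (J : Set R) * (I ^ n) ^ (r + 1)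
      = (I ^ (n + 1)).colon (J : Set R) * J * I ^ (r + l) := by
        rw [← pow_mul, hl, mul_assoc, mul_pow_eq_of_le hr (Nat.le_add_right r l),
          Nat.add_right_comm]
    _ ≤ I ^ (n + 1) * I ^ (r + l) := Ideal.mul_mono_left (le_colon_iff_mul_le.mp le_rfl)
    _ = (I ^ n) ^ (r + 1 + 1) := by rw [← pow_add, ← pow_mul, Nat.mul_succ, hl]; congr 1; lia

theorem colon_pow_eq (hJ : IsReduction I J) {n : ℕ} (hn : 1 ≤ n)
    (hr : ratliffRush (I ^ n) = I ^ n) : (I ^ (n + 1)).colon (J : Set R) = I ^ n :=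
  le_antisymm ((hJ.colon_le_ratliffRush hn).trans hr.le) <|
    le_colon_iff_mul_le.mpr <| (pow_succ I n).ge.trans' (Ideal.mul_mono_right hJ.1)

end IsReduction

end RatliffRush

section ReductionCriterion

variable {R : Type*} [CommRing R] [IsLocalRing R] [IsNoetherianRing R] {I : Ideal R}

theorem natCast_hilbertFunction (hI : I.radical = IsLocalRing.maximalIdeal R) (n : ℕ) :
    (hilbertFunction I n : ℕ∞) = Module.length R (R ⧸ I ^ n) := by
  rw [hilbertFunction, Int.toNat_natCast,
    ENat.natCast_toNat (length_quotient_pow_ne_top_of_radical_eq hI n)]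

theorem mul_pow_eq_iff {x y : R} (hxy : IsKoszulExact x y)
    (hI : I.radical = IsLocalRing.maximalIdeal R) (hJ : IsReduction I (Ideal.span {x, y}))
    {n : ℕ} (hcolon : (I ^ (n + 1)).colon (Ideal.span {x, y} : Ideal R) = I ^ n) :
    Ideal.span {x, y} * I ^ (n + 1) = I ^ (n + 2) ↔
      (Δ_[1])^[2] (fun t : ℤ => (hilbertFunction I t : ℚ)) n =
        (Module.length R (R ⧸ Ideal.span {x, y})).toNat := by
  set J := Ideal.span {x, y} with hJ_def
  have hle : J * I ^ (n + 1) ≤ I ^ (n + 2) := by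
    rw [pow_succ' I (n + 1)]
    exact Ideal.mul_mono_left hJ.1
  have hfin := length_quotient_pow_ne_top_of_radical_eq hI
  have hJfin := length_quotient_ne_top_of_radical_eq (hJ.radical_eq.trans hI)
  have hlength := length_quotient_mul_add hxy (I ^ (n + 1))
  rw [← hJ_def, hcolon] at hlength
  calc J * I ^ (n + 1) = I ^ (n + 2)
      ↔ Module.length R (R ⧸ J * I ^ (n + 1)) = Module.length R (R ⧸ I ^ (n + 2)) :=
        ⟨fun h => by rw [h], eq_of_le_of_length_quotient_eq hle (hfin _)⟩
    _ ↔ Module.length R (R ⧸ I ^ n) + Module.length R (R ⧸ I ^ (n + 2)) =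
          2 * Module.length R (R ⧸ I ^ (n + 1)) + Module.length R (R ⧸ J) := by
        rw [← hlength, (ENat.addLECancellable_of_ne_top (hfin n)).inj, eq_comm]
    _ ↔ hilbertFunction I n + hilbertFunction I (n + 2 : ℕ) =
          2 * hilbertFunction I (n + 1 : ℕ) + (Module.length R (R ⧸ J)).toNat := by
        rw [← ENat.natCast_toNat hJfin]
        simp only [← natCast_hilbertFunction hI]
        norm_cast
    _ ↔ _ := by
        rw [← Nat.cast_inj (R := ℚ)]
        simp only [Function.iterate_succ, Function.iterate_zero, Function.comp_apply, id, fwdDiff]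
        push_cast
        rw [add_assoc (n : ℤ), one_add_one_eq_two]
        constructor <;> intro h <;> linear_combination h

theorem IsReduction.mul_pow_stabilityIndex_add_one (hd : 2 ≤ depth R)
    (hI : I.radical = IsLocalRing.maximalIdeal R) {x y : R}
    (hJ : IsReduction I (Ideal.span {x, y})) (hn : postulationNumber I < stabilityIndex I) :
    Ideal.span {x, y} * I ^ (stabilityIndex I + 1) = I ^ (stabilityIndex I + 2) := by
  obtain ⟨f, hf, g, hg, hfg⟩ :=
    exists_isWeaklyRegular_pair_of_two_le_depth hd (hJ.radical_eq.trans hI)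
  have hf_reg : IsSMulRegular R f :=
    ((RingTheory.Sequence.isWeaklyRegular_cons_iff R f [g]).mp hfg).1
  obtain ⟨hρ_pos, hρ⟩ := stabilityIndex_spec (hJ.1 hf) hf_reg
  have criterion (n : ℕ) (hn : stabilityIndex I ≤ n) :=
    mul_pow_eq_iff (isKoszulExact_of_isWeaklyRegular hf hg hfg) hI hJ
      (hJ.colon_pow_eq (hρ_pos.trans hn) (hρ n hn))
  obtain ⟨r, hr⟩ := hJ.2
  refine (criterion _ le_rfl).mpr
    (fwdDiff_iter_hilbertFunction_eq (N := max (stabilityIndex I) r) (fun n hn => ?_) hn)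
  lift n to ℕ using by lia
  exact (criterion n (by lia)).mp (mul_pow_eq_of_le hr (by lia))

end ReductionCriterion

end HilbertSamuel

open HilbertSamuel in
theorem theorem3p6_general {R : Type*} [CommRing R] [IsLocalRing R] [IsNoetherianRing R]
    (hd : 2 ≤ depth R) {I : Ideal R} (hI : I.radical = IsLocalRing.maximalIdeal R)
    {x y : R} (hJ : IsMinimalReduction I (Ideal.span {x, y}))
    (hn : postulationNumber I < stabilityIndex I) :
    reductionNumber I ≤ stabilityIndex I + 1 ∧
      reductionNumberWrt I (Ideal.span {x, y}) ≤ stabilityIndex I + 1 := by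
  have hrd : reductionNumberWrt I (Ideal.span {x, y}) ≤ stabilityIndex I + 1 :=
    Nat.sInf_le (hJ.prop.mul_pow_stabilityIndex_add_one hd hI hn)
  have hrd_le : reductionNumber I ≤ reductionNumberWrt I (Ideal.span {x, y}) :=
    Nat.sInf_le ⟨_, hJ, rfl⟩
  exact ⟨hrd_le.trans hrd, hrd⟩

theorem theorem3p6 {R : Type*} [CommRing R] [IsLocalRing R]
    (hCM : HilbertSamuel.IsCohenMacaulayLocal R) (hdim : ringKrullDim R = 2)
    (I : Ideal R) (hI : HilbertSamuel.IsMPrimary I)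
    (J : Ideal R) (x y : R) (hJxy : J = Ideal.span {x, y})
    (hJ : HilbertSamuel.IsMinimalReduction I J)
    (hx : HilbertSamuel.IsSuperficial I x)
    (hn : HilbertSamuel.postulationNumber I = (HilbertSamuel.stabilityIndex I : ℤ) - 1) :
    (HilbertSamuel.reductionNumber I : ℤ) ≤ HilbertSamuel.postulationNumber I + 2 ∧
      HilbertSamuel.reductionNumberWrt I J ≤ HilbertSamuel.stabilityIndex I + 1 := by
  have := hCM.noetherian
  have hdepth : 2 ≤ HilbertSamuel.depth R :=
    WithBot.coe_le_coe.mp (hdim.symm.trans hCM.depth_eq_dim.symm).le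
  subst hJxy
  obtain ⟨hrd, hrdJ⟩ := theorem3p6_general hdepth hI.2 hJ (by lia)
  exact ⟨by lia, hrdJ⟩
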